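/- All graphs are finite and simple. A cover of a graph $G$ is a pair $(L,H)$, where $H$ is a graph and $L$ assigns to each vertex of $G$ a set of vertices of $H$, such that the sets $L(u)$, $u\in V(G)$, partition $V(H)$; each $L(u)$ induces a complete graph in $H$; there are no edges of $H$ between $L(u)$ and $L(v)$ if $u\neq v$ are not adjacent in $G$; and the edges of $H$ between $L(u)$ and $L(v)$ form a matching if $uv\in E(G)$. The cover is $t$-fold if $|L(u)|=t$ for all $u\in V(G)$. The DP-chromatic number $\chi_{DP}(G)$ is the least $t$ such that for every $t$-fold cover $(L,H)$ of $G$, the graph $H$ has an independent set of size $|V(G)|$. Let $G\vee K_s$ be the join of $G$ and the complete graph on $s$ vertices, $\chi$ the chromatic number, and $$Z_{DP}(G)=\min\{s\in\mathbb{Z}_{\ge 0} : \chi_{DP}(G\vee K_s)=\chi(G\vee K_s)\}.$$ Theorem 1.8. Let $G$ be a graph with $n$ vertices, $m$ edges and chromatic number $k$. - If $2\le k\le n-3$, then $Z_{DP}(G)\le \left\lceil \frac{4(k+1)m}{2k+1}\right\rceil\le\lceil 2.4m\rceil$. - If $G\cong C_4$, then $Z_{DP}(G)=1$. - Otherwise,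 $Z_{DP}(G)=0$. -/

import Mathlib

universe u

namespace DPColoring

/-- The join `G ∨ H`: the disjoint union of `G` and `H` together with all edges between them. -/
def join {V W : Type*} (G : SimpleGraph V) (H : SimpleGraph W) : SimpleGraph (V ⊕ W) :=
  (G ⊕g H) ⊔ completeBipartiteGraph V W

/-- A cover `(L, H)` of `G`, where `H` is a graph on the vertex set `W`. -/
structure Cover {V : Type*} (G : SimpleGraph V) (W : Type*) where
  /-- the graph `H` of the cover -/
  H : SimpleGraph W
  /-- the set of vertices of `H` assigned to a vertex of `G` -/
  L : V → Set W
  /-- the sets `L u` are pairwise disjoint ... -/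
  disjoint : ∀ u v : V, u ≠ v → Disjoint (L u) (L v)
  /-- ... and cover the vertex set of `H` -/
  iUnion_eq : ⋃ u, L u = Set.univ
  /-- each `L u` induces a complete graph in `H` -/
  isClique : ∀ u : V, H.IsClique (L u)
  /-- no edges of `H` between `L u` and `L v` for distinct non-adjacent `u`, `v` -/
  not_adj : ∀ u v : V, u ≠ v → ¬ G.Adj u v → ∀ a ∈ L u, ∀ b ∈ L v, ¬ H.Adj a b
  /-- the edges of `H` between `L u` and `L v` form a matching if `u`, `v` are adjacent: two of
  them that share an end are equal (shared ends in `L v` are covered by exchanging `u`, `v`) -/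
  matching : ∀ u v : V, G.Adj u v → ∀ a ∈ L u, ∀ b ∈ L v, ∀ b' ∈ L v,
    H.Adj a b → H.Adj a b' → b = b'

/-- A cover is `m`-fold if every `L v` has exactly `m` elements. -/
def Cover.IsFold {V W : Type*} {G : SimpleGraph V} (C : Cover G W) (m : ℕ) : Prop :=
  ∀ v : V, (C.L v).encard = m

/-- `G` is colorable with respect to the cover `(L, H)`: there is an independent set of `H`
of size `|V(G)|`. -/
def Cover.IsColorable {V W : Type*} [Fintype V] {G : SimpleGraph V} (C : Cover G W) : Prop :=
  ∃ I : Set W, C.H.IsIndepSet I ∧ I.encard = Fintype.card V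

/-- `G` is colorable with respect to each of its `m`-fold covers. (An `m`-fold cover has
`m * |V(G)|` vertices, so vertex sets in the universe of `V` suffice.) -/
def DPColorable {V : Type u} [Fintype V] (G : SimpleGraph V) (m : ℕ) : Prop :=
  ∀ (W : Type u) (C : Cover G W), C.IsFold m → C.IsColorable

/-- The DP-chromatic number: the least `m` such that `G` is colorable with respect to each of its
`m`-fold covers (`⊤` if there were none, as for `SimpleGraph.chromaticNumber`). If `V` is nonempty,
then such an `m` is positive, see `DPColorable.pos`. -/
noncomputable def dpChromaticNumber {V : Type u} [Fintype V] (G : SimpleGraph V) : ℕ∞ :=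
  ⨅ m ∈ {m : ℕ | DPColorable G m}, (m : ℕ∞)

/-- A graph with at least one vertex is not colorable with respect to its `0`-fold cover. -/
theorem DPColorable.pos {V : Type u} [Fintype V] [Nonempty V] {G : SimpleGraph V} {m : ℕ}
    (h : DPColorable G m) : 0 < m := by
  rcases Nat.eq_zero_or_pos m with rfl | hm
  · exfalso
    obtain ⟨I, -, hI⟩ := h PEmpty
      { H := ⊥
        L := fun _ => ∅
        disjoint := by simp
        iUnion_eq := Subsingleton.elim _ _
        isClique := by simp
        not_adj := by simp
        matching := by simp } (by intro v; simp)
    rw [Set.eq_empty_of_isEmpty I, Set.encard_empty] at hI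
    have : Fintype.card V = 0 := by exact_mod_cast hI.symm
    exact Fintype.card_ne_zero this
  · exact hm

/-- `Z_DP(G)`: the least `s` such that `χ_DP(G ∨ K_s) = χ(G ∨ K_s)` (`⊤` if there were none). -/
noncomputable def ZDP {V : Type u} [Fintype V] (G : SimpleGraph V) : ℕ∞ :=
  ⨅ s ∈ {s : ℕ | dpChromaticNumber (join G (⊤ : SimpleGraph (Fin s))) =
    (join G (⊤ : SimpleGraph (Fin s))).chromaticNumber}, (s : ℕ∞)

end DPColoring

/-! The first bound holds in the stronger form `Z_DP(G) ≤ 2m`. Adjoin a clique `B` of `s = 2m`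
vertices and give every vertex a list of at least `k + s` elements, lists being joined by matchings.
The excess of a vertex of `G` is then at most its degree, so the total excess is at most `2m = |B|`.
`JoinLists.hasTransversal` shows that total excess at most `|B|` suffices.

Its proof is an induction on `|U| + |B| + k`. A vertex whose list is longer than its degree in the
join is coloured last. Otherwise all excesses are positive, and choosing `x` for a vertex of `B`
lowers `|B|` by one and lowers the excess of every vertex of `U` whose list `x` misses. If `x` has
neighbours in all lists of a colour class, that class can be coloured by these neighbours. When `x`
is closed, this costs each list of `B` at most one element, and `k` drops by one
(`JoinLists.exists_class`). When `x` is not closed, choosing it creates an element `w` that misses a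
vertex, which makes up for a deficit of one at a later step.

For `n ≤ k + 2`, two equal pairs of colours or a triple reduce the problem to greedy orders, except
for a four-cycle joined to a clique. One clique vertex already makes that case colourable
(`hasTransversal_wheel`); the bare four-cycle fails by a twisted twofold cover. -/

namespace DPColoring

/-! ### Greedy choices from lists joined by matchings -/

section Transversal

open Classical

variable {P X : Type*}

/-- Distinct lists are joined by matchings of `H`. -/
def MatchingLists (H : SimpleGraph X) (L : P → Finset X) : Prop :=
  ∀ p q, p ≠ q → ∀ x ∈ L p, ∀ y ∈ L q, ∀ y' ∈ L q, H.Adj x y → H.Adj x y' → y = y'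

/-- The lists that are left when the neighbours of `C` are deleted. -/
noncomputable def after (H : SimpleGraph X) (L : P → Finset X) (C : Finset X) : P → Finset X :=
  fun q => (L q).filter fun y => ∀ c ∈ C, ¬ H.Adj c y

/-- An independent choice of one element from each list `L p` with `p ∈ T`. -/
def HasTransversal (H : SimpleGraph X) (L : P → Finset X) (T : Finset P) : Prop :=
  ∃ φ : P → X, (∀ p ∈ T, φ p ∈ L p) ∧ ∀ p ∈ T, ∀ q ∈ T, p ≠ q → ¬ H.Adj (φ p) (φ q)

variable {H : SimpleGraph X} {L : P → Finset X}

lemma mem_after {C : Finset X} {q : P} {y : X} :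
    y ∈ after H L C q ↔ y ∈ L q ∧ ∀ c ∈ C, ¬ H.Adj c y := by
  simp [after]

lemma after_subset (C : Finset X) (q : P) : after H L C q ⊆ L q :=
  Finset.filter_subset _ _

lemma card_after_le (C : Finset X) (q : P) : (after H L C q).card ≤ (L q).card :=
  Finset.card_le_card (after_subset C q)

lemma MatchingLists.after (hL : MatchingLists H L) (C : Finset X) :
    MatchingLists H (after H L C) :=
  fun p q hpq x hx y hy y' hy' => hL p q hpq x (after_subset C p hx) y (after_subset C q hy) y'
    (after_subset C q hy')

lemma HasTransversal.mono {T T' : Finset P} (h : HasTransversal H L T) (hT : ∀ p ∈ T', p ∈ T) :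
    HasTransversal H L T' := by
  obtain ⟨φ, hφ, hind⟩ := h
  exact ⟨φ, fun p hp => hφ p (hT p hp), fun p hp q hq => hind p (hT p hp) q (hT q hq)⟩

lemma HasTransversal.of_after {S T : Finset P} {g : P → X} (hST : Disjoint S T)
    (hg : ∀ p ∈ S, g p ∈ L p) (hS : ∀ p ∈ S, ∀ q ∈ S, p ≠ q → ¬ H.Adj (g p) (g q))
    (h : HasTransversal H (after H L (S.image g)) T) : HasTransversal H L (S ∪ T) := by
  obtain ⟨φ, hφ, hind⟩ := h
  have key : ∀ p ∈ S, ∀ q ∈ T, ¬ H.Adj (g p) (φ q) := fun p hp q hq =>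
    (mem_after.1 (hφ q hq)).2 _ (Finset.mem_image_of_mem g hp)
  have hT : ∀ q ∈ T, q ∉ S := fun q hq hq' => Finset.disjoint_left.1 hST hq' hq
  refine ⟨fun p => if p ∈ S then g p else φ p, ?_, ?_⟩
  · intro p hp
    rcases Finset.mem_union.1 hp with hp | hp
    · simpa [hp] using hg p hp
    · simpa [hT p hp] using (mem_after.1 (hφ p hp)).1
  · intro p hp q hq hpq
    rcases Finset.mem_union.1 hp with hp | hp <;> rcases Finset.mem_union.1 hq with hq | hq
    · simpa [hp, hq] using hS p hp q hq hpq
    · simpa [hp, hT q hq] using key p hp q hq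
    · simpa [hq, hT p hp] using fun h' => key q hq p hp (H.adj_symm h')
    · simpa [hT p hp, hT q hq] using hind p hp q hq hpq

lemma HasTransversal.of_after_singleton {b : P} {x : X} {T : Finset P} (hb : b ∉ T)
    (hx : x ∈ L b) (h : HasTransversal H (DPColoring.after H L {x}) T) :
    HasTransversal H L (insert b T) := by
  have := HasTransversal.of_after (S := {b}) (T := T) (g := fun _ => x) (by simpa using hb)
    (by simpa using hx) (fun p hp q hq hpq => absurd
      ((Finset.mem_singleton.1 hp).trans (Finset.mem_singleton.1 hq).symm) hpq) (by simpa using h)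
  rwa [← Finset.insert_eq] at this

/-- Only choices at vertices of `N` can block elements of `L v`, and by the matching condition each
blocks at most one, so a free element remains. -/
lemma HasTransversal.insert_last (hL : MatchingLists H L) {v : P} {T N : Finset P} (hv : v ∉ T)
    (hN : ∀ q ∈ T, q ∉ N → ∀ x ∈ L q, ∀ y ∈ L v, ¬ H.Adj x y) (hcard : N.card < (L v).card)
    (h : HasTransversal H L T) : HasTransversal H L (insert v T) := by
  obtain ⟨φ, hφ, hind⟩ := h
  have : ∃ y ∈ L v, ∀ q ∈ T, ¬ H.Adj (φ q) y := by
    by_contra! hcon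
    have : Nonempty P := ⟨v⟩
    choose! r hr hadj using hcon
    refine absurd (Finset.card_le_card_of_injOn (s := L v) (t := N) r ?_ ?_) (by omega)
    · intro y hy
      by_contra hn
      exact hN _ (hr y hy) hn _ (hφ _ (hr y hy)) y hy (hadj y hy)
    · intro y hy y' hy' he
      refine hL (r y) v (fun e => hv (e ▸ hr y hy)) _ (hφ _ (hr y hy)) y hy y' hy' (hadj y hy) ?_
      rw [he]; exact hadj y' hy'
  obtain ⟨y, hy, hyq⟩ := this
  have hT : ∀ q ∈ T, q ≠ v := fun q hq e => hv (e ▸ hq)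
  refine ⟨Function.update φ v y, ?_, ?_⟩
  · intro p hp
    rcases Finset.mem_insert.1 hp with rfl | hp
    · simpa using hy
    · simpa [hT p hp] using hφ p hp
  · intro p hp q hq hpq
    rcases Finset.mem_insert.1 hp with hp | hp <;> rcases Finset.mem_insert.1 hq with hq | hq
    · exact absurd (hp.trans hq.symm) hpq
    · simpa [hp, hT q hq] using fun h' => hyq q hq (H.adj_symm h')
    · simpa [hq, hT p hp] using hyq p hp
    · simpa [hT p hp, hT q hq] using hind p hp q hq hpq

lemma HasTransversal.of_card_le [Nonempty X] (hL : MatchingLists H L) (T : Finset P)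
    (h : ∀ p ∈ T, T.card ≤ (L p).card) : HasTransversal H L T := by
  suffices ∀ S ⊆ T, HasTransversal H L S from this T subset_rfl
  intro S
  induction S using Finset.induction_on with
  | empty =>
    intro _
    exact ⟨fun _ => Classical.arbitrary X, by simp, by simp⟩
  | insert v S hv ih =>
    intro hS
    have hS' := (Finset.insert_subset_iff.1 hS)
    refine (ih hS'.2).insert_last hL hv (N := S) (fun q hq hn => absurd hq hn) ?_
    have := Finset.card_le_card hS
    rw [Finset.card_insert_of_notMem hv] at this
    have := h v hS'.1
    omega

/-- Each chosen element at a vertex of `R` deletes at most one element of `L q`, and the other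
choices delete none. -/
lemma card_le_card_after_add (hL : MatchingLists H L) {S R : Finset P} {g : P → X} {q : P}
    (hq : q ∉ S) (hg : ∀ p ∈ S, g p ∈ L p)
    (hR : ∀ p ∈ S, p ∉ R → ∀ y ∈ L q, ¬ H.Adj (g p) y) :
    (L q).card ≤ (after H L (S.image g) q).card + R.card := by
  have hbad : ((L q).filter fun y => ¬ ∀ c ∈ S.image g, ¬ H.Adj c y).card ≤ R.card := by
    have hex : ∀ y ∈ (L q).filter (fun y => ¬ ∀ c ∈ S.image g, ¬ H.Adj c y),
        ∃ p ∈ S, H.Adj (g p) y := by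
      intro y hy
      simpa using (Finset.mem_filter.1 hy).2
    have : Nonempty P := ⟨q⟩
    choose! r hr hadj using hex
    refine Finset.card_le_card_of_injOn r ?_ ?_
    · intro y hy
      by_contra hn
      exact hR _ (hr y hy) hn y (Finset.mem_filter.1 hy).1 (hadj y hy)
    · intro y hy y' hy' he
      refine hL (r y) q (fun e => hq (e ▸ hr y hy)) _ (hg _ (hr y hy)) y
        (Finset.mem_filter.1 hy).1 y' (Finset.mem_filter.1 hy').1 (hadj y hy) ?_
      rw [he]; exact hadj y' hy'
  have := Finset.card_filter_add_card_filter_not (s := L q)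
    (fun y => ∀ c ∈ S.image g, ¬ H.Adj c y)
  unfold after
  omega

lemma card_le_card_after_singleton (hL : MatchingLists H L) {b q : P} {x : X} (hq : q ≠ b)
    (hx : x ∈ L b) : (L q).card ≤ (after H L {x} q).card + 1 := by
  simpa using card_le_card_after_add hL (S := {b}) (R := {b}) (g := fun _ => x) (q := q)
    (by simpa using hq) (by simpa using hx) (by simp)

lemma after_singleton_eq {q : P} {x : X} (hx : ∀ y ∈ L q, ¬ H.Adj x y) :
    after H L {x} q = L q := by
  ext y
  simpa [mem_after] using hx y

end Transversal

/-! ### Joins with a clique: total excess at most `|B|` suffices -/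

section Excess

open Classical

variable {P X : Type*} {J : SimpleGraph P} {H : SimpleGraph X} {U B : Finset P}
  {L : P → Finset X} {k : ℕ} {f : P → ℕ}

/-- Lists for the join of `J[U]`, which `f` colours properly with `k` colours, and a clique on `B`,
with sufficiently large lists on `B`. -/
structure JoinLists (J : SimpleGraph P) (H : SimpleGraph X) (U B : Finset P) (L : P → Finset X)
    (k : ℕ) (f : P → ℕ) : Prop where
  disj : Disjoint U B
  matching : MatchingLists H L
  nonadj : ∀ u ∈ U, ∀ v ∈ U, u ≠ v → ¬ J.Adj u v → ∀ x ∈ L u, ∀ y ∈ L v, ¬ H.Adj x y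
  lt : ∀ u ∈ U, f u < k
  ne : ∀ u ∈ U, ∀ v ∈ U, J.Adj u v → f u ≠ f v
  card_le : ∀ b ∈ B, B.card + k ≤ (L b).card

/-- By how much the list of `v` falls short of `deg v + |B| + k`. -/
noncomputable def excess (J : SimpleGraph P) (U B : Finset P) (L : P → Finset X) (k : ℕ) (v : P) :
    ℕ :=
  (U.filter (J.Adj v)).card + B.card + k - (L v).card

lemma JoinLists.ne_of_mem (h : JoinLists J H U B L k f) {u b : P} (hu : u ∈ U) (hb : b ∈ B) :
    u ≠ b := fun e => Finset.disjoint_left.1 h.disj hu (e ▸ hb)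

lemma JoinLists.erase (h : JoinLists J H U B L k f) (v : P) :
    JoinLists J H (U.erase v) B L k f where
  disj := Finset.disjoint_of_subset_left (Finset.erase_subset _ _) h.disj
  matching := h.matching
  nonadj := fun u hu w hw => h.nonadj u (Finset.mem_of_mem_erase hu) w (Finset.mem_of_mem_erase hw)
  lt := fun u hu => h.lt u (Finset.mem_of_mem_erase hu)
  ne := fun u hu w hw => h.ne u (Finset.mem_of_mem_erase hu) w (Finset.mem_of_mem_erase hw)
  card_le := h.card_le

lemma sum_excess_erase_add_le {v : P} (hv : v ∈ U) :
    ∑ u ∈ U.erase v, excess J (U.erase v) B L k u + excess J U B L k v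
      ≤ ∑ u ∈ U, excess J U B L k u := by
  rw [← Finset.sum_erase_add U _ hv]
  gcongr with u hu
  unfold excess
  have : ((U.erase v).filter (J.Adj u)).card ≤ (U.filter (J.Adj u)).card :=
    Finset.card_le_card (Finset.filter_subset_filter _ (Finset.erase_subset _ _))
  omega

lemma JoinLists.hasTransversal_of_erase (h : JoinLists J H U B L k f) {v : P} (hv : v ∈ U)
    (hcard : (U.filter (J.Adj v)).card + B.card < (L v).card)
    (ht : HasTransversal H L (U.erase v ∪ B)) : HasTransversal H L (U ∪ B) := by
  have hvB : v ∉ B := Finset.disjoint_left.1 h.disj hv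
  have := ht.insert_last h.matching (v := v) (N := U.filter (J.Adj v) ∪ B) (by simp [hvB]) ?_ ?_
  · rwa [← Finset.insert_union, Finset.insert_erase hv] at this
  · intro q hq hqN x hx y hy
    simp only [Finset.mem_union, Finset.mem_erase, Finset.mem_filter] at hq hqN
    rcases hq with hq | hq
    · exact h.nonadj q hq.2 v hv hq.1 (fun e => hqN (Or.inl ⟨hq.2, e.symm⟩)) x hx y hy
    · exact absurd (Or.inr hq) hqN
  · exact (Finset.card_union_le _ _).trans_lt hcard

lemma JoinLists.pick (h : JoinLists J H U B L k f) {b : P} (hb : b ∈ B) {x : X} (hx : x ∈ L b) :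
    JoinLists J H U (B.erase b) (after H L {x}) k f where
  disj := Finset.disjoint_of_subset_right (Finset.erase_subset _ _) h.disj
  matching := h.matching.after _
  nonadj := fun u hu w hw e e' y hy z hz =>
    h.nonadj u hu w hw e e' y (after_subset _ _ hy) z (after_subset _ _ hz)
  lt := h.lt
  ne := h.ne
  card_le := fun c hc => by
    have := h.card_le c (Finset.mem_of_mem_erase hc)
    have := card_le_card_after_singleton h.matching (Finset.ne_of_mem_erase hc) hx
    have := Finset.card_erase_add_one hb
    omega

lemma JoinLists.hasTransversal_of_pick (h : JoinLists J H U B L k f) {b : P} (hb : b ∈ B) {x : X}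
    (hx : x ∈ L b) (ht : HasTransversal H (after H L {x}) (U ∪ B.erase b)) :
    HasTransversal H L (U ∪ B) := by
  have hbU : b ∉ U := Finset.disjoint_right.1 h.disj hb
  have := ht.of_after_singleton (by simp [hbU]) hx
  rwa [← Finset.union_insert, Finset.insert_erase hb] at this

/-- The loss of at most one list element is offset by the drop of `|B|`. -/
lemma JoinLists.excess_pick_le (h : JoinLists J H U B L k f) {b v : P} (hb : b ∈ B) {x : X}
    (hx : x ∈ L b) (hv : v ∈ U) :
    excess J U (B.erase b) (after H L {x}) k v ≤ excess J U B L k v := by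
  have := card_le_card_after_singleton h.matching (h.ne_of_mem hv hb) hx
  have := Finset.card_erase_add_one hb
  unfold excess
  omega

lemma le_excess_pick {b v : P} (hb : b ∈ B) {x : X} :
    excess J U B L k v ≤ excess J U (B.erase b) (after H L {x}) k v + 1 := by
  have := card_after_le (H := H) (L := L) {x} v
  have := Finset.card_erase_add_one hb
  unfold excess
  omega

/-- Here the list loses nothing while `|B|` drops. Positivity is needed because the subtraction in
`excess` is truncated. -/
lemma excess_pick_add_one_le {b v : P} (hb : b ∈ B) {x : X} (hx : ∀ y ∈ L v, ¬ H.Adj x y)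
    (hpos : 1 ≤ excess J U B L k v) :
    excess J U (B.erase b) (after H L {x}) k v + 1 ≤ excess J U B L k v := by
  have := Finset.card_erase_add_one hb
  unfold excess at *
  rw [after_singleton_eq hx]
  omega

/-- `x ∈ L b` is closed if each element of another list of `B` that has a common neighbour with `x`
in a list of `U` is adjacent to `x`. -/
def IsClosedAt (H : SimpleGraph X) (U B : Finset P) (L : P → Finset X) (b : P) (x : X) : Prop :=
  ∀ c ∈ B, c ≠ b → ∀ w ∈ L c, ∀ v ∈ U, ∀ y ∈ L v, H.Adj x y → H.Adj w y → H.Adj x w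

/-- Colour the class `c` by the neighbours of a closed element. -/
lemma JoinLists.exists_class (h : JoinLists J H U B L k f) {b : P} (hb : b ∈ B) {x : X}
    (hx : x ∈ L b) (hcl : IsClosedAt H U B L b x) {c : ℕ} (hc : c < k)
    (hrow : ∀ v ∈ U, f v = c → ∃ y ∈ L v, H.Adj x y) :
    ∃ L' : P → Finset X, ∃ f' : P → ℕ,
      JoinLists J H (U.filter (f · ≠ c)) B L' (k - 1) f' ∧
      (∀ v ∈ U, f v ≠ c → excess J (U.filter (f · ≠ c)) B L' (k - 1) v ≤ excess J U B L k v - 1) ∧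
      (HasTransversal H L' (U.filter (f · ≠ c) ∪ B) → HasTransversal H L (U ∪ B)) := by
  have : Nonempty X := ⟨x⟩
  choose! g hg hxg using hrow
  set S := U.filter (f · = c) with hS
  have hSm : ∀ v, v ∈ S ↔ v ∈ U ∧ f v = c := fun v => by simp [hS]
  have hgS : ∀ p ∈ S, g p ∈ L p := fun p hp => hg p ((hSm p).1 hp).1 ((hSm p).1 hp).2
  -- Colour `c` has become free; renaming colour `k - 1` to `c` leaves only colours below `k - 1`.
  refine ⟨after H L (S.image g), fun u => if f u = k - 1 then c else f u, ⟨?_, ?_, ?_, ?_, ?_, ?_⟩,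
    ?_, ?_⟩
  · exact Finset.disjoint_of_subset_left (Finset.filter_subset _ _) h.disj
  · exact h.matching.after _
  · exact fun u hu w hw e e' y hy z hz => h.nonadj u (Finset.mem_filter.1 hu).1 w
      (Finset.mem_filter.1 hw).1 e e' y (after_subset _ _ hy) z (after_subset _ _ hz)
  · intro u hu
    have := h.lt u (Finset.mem_filter.1 hu).1
    have := (Finset.mem_filter.1 hu).2
    split_ifs <;> omega
  · intro u hu w hw huw
    have := h.ne u (Finset.mem_filter.1 hu).1 w (Finset.mem_filter.1 hw).1 huw
    have := (Finset.mem_filter.1 hu).2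
    have := (Finset.mem_filter.1 hw).2
    split_ifs <;> omega
  · intro d hd
    have h1 := h.card_le d hd
    -- In `L b` only `x` itself is lost. In another list of `B` every lost element is adjacent to
    -- `x` by closedness, so there is at most one.
    have key : (L d).card ≤ (after H L (S.image g) d).card + 1 := by
      by_contra! hlt
      have h2 : 1 < (L d \ after H L (S.image g) d).card := by
        have := Finset.card_sdiff_add_card_eq_card (after_subset (H := H) (L := L) (S.image g) d)
        omega
      obtain ⟨w, hw, w', hw', hne⟩ := Finset.one_lt_card.1 h2
      have hex : ∀ w ∈ L d \ after H L (S.image g) d, ∃ p ∈ S, H.Adj (g p) w := by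
        intro w hw
        simpa [mem_after, (Finset.mem_sdiff.1 hw).1] using (Finset.mem_sdiff.1 hw).2
      have hwd := (Finset.mem_sdiff.1 hw).1
      have hwd' := (Finset.mem_sdiff.1 hw').1
      obtain ⟨p, hp, hpw⟩ := hex w hw
      obtain ⟨p', hp', hpw'⟩ := hex w' hw'
      have hpU := (hSm p).1 hp
      have hpU' := (hSm p').1 hp'
      by_cases hdb : d = b
      · subst hdb
        refine hne (((h.matching p d (h.ne_of_mem hpU.1 hb) (g p) (hgS p hp) w hwd x hx hpw
          (hxg p hpU.1 hpU.2).symm)).trans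
          ((h.matching p' d (h.ne_of_mem hpU'.1 hb) (g p') (hgS p' hp') w' hwd' x hx hpw'
          (hxg p' hpU'.1 hpU'.2).symm)).symm)
      · refine hne (h.matching b d (Ne.symm hdb) x hx w hwd w' hwd' ?_ ?_)
        · exact hcl d hd hdb w hwd p hpU.1 (g p) (hgS p hp) (hxg p hpU.1 hpU.2) hpw.symm
        · exact hcl d hd hdb w' hwd' p' hpU'.1 (g p') (hgS p' hp') (hxg p' hpU'.1 hpU'.2) hpw'.symm
    omega
  · intro v hv hvc
    -- The list of `v` loses at most as many elements as `v` loses neighbours, so the drop of `k`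
    -- lowers the excess.
    have h1 : (L v).card ≤ (after H L (S.image g) v).card + (S.filter (J.Adj v)).card := by
      refine card_le_card_after_add h.matching (fun hvS => hvc ((hSm v).1 hvS).2) hgS ?_
      intro p hp hpR y hy
      refine h.nonadj p ((hSm p).1 hp).1 v hv ?_ ?_ _ (hgS p hp) y hy
      · rintro rfl; exact hvc ((hSm _).1 hp).2
      · intro hadj
        exact hpR (Finset.mem_filter.2 ⟨hp, hadj.symm⟩)
    have h2 : (U.filter (J.Adj v)).card = (S.filter (J.Adj v)).card +
        ((U.filter (f · ≠ c)).filter (J.Adj v)).card := by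
      rw [← Finset.card_filter_add_card_filter_not (s := U.filter (J.Adj v)) (f · = c)]
      congr 2 <;> simp only [hS, Finset.filter_filter, and_comm]
    unfold excess
    omega
  · intro ht
    have hdis : Disjoint S (U.filter (f · ≠ c) ∪ B) := by
      rw [Finset.disjoint_left]
      intro p hp hp'
      rcases Finset.mem_union.1 hp' with hp' | hp'
      · exact (Finset.mem_filter.1 hp').2 ((hSm p).1 hp).2
      · exact h.ne_of_mem ((hSm p).1 hp).1 hp' rfl
    have := HasTransversal.of_after hdis hgS ?_ ht
    · rwa [← Finset.union_assoc, Finset.filter_union_filter_not_eq] at this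
    · intro p hp q hq hpq
      refine h.nonadj p ((hSm p).1 hp).1 q ((hSm q).1 hq).1 hpq ?_ _ (hgS p hp) _ (hgS q hq)
      intro hadj
      exact h.ne p ((hSm p).1 hp).1 q ((hSm q).1 hq).1 hadj
        (((hSm p).1 hp).2.trans ((hSm q).1 hq).2.symm)

/-- The second alternative is the state after choosing an element that is not closed: the total may
exceed `|B|` by one, but some element of a list of `B` misses a list of `U`, so choosing it does not
increase the deficit. -/
theorem JoinLists.hasTransversal_aux [Nonempty X] (N : ℕ) :
    ∀ (U B : Finset P) (L : P → Finset X) (k : ℕ) (f : P → ℕ),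
      U.card + B.card + k ≤ N → JoinLists J H U B L k f →
      (∑ v ∈ U, excess J U B L k v ≤ B.card ∨
        (2 ≤ k ∧ ∑ v ∈ U, excess J U B L k v ≤ B.card + 1 ∧ (∀ v ∈ U, 1 ≤ excess J U B L k v) ∧
          ∃ b ∈ B, ∃ x ∈ L b, ∃ v ∈ U, ∀ y ∈ L v, ¬ H.Adj x y)) →
      HasTransversal H L (U ∪ B) := by
  induction N with
  | zero =>
    intro U B L k f hN h _
    refine HasTransversal.of_card_le h.matching _ ?_
    have hU : U = ∅ := Finset.card_eq_zero.1 (by omega)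
    have hB : B = ∅ := Finset.card_eq_zero.1 (by omega)
    simp [hU, hB]
  | succ N ih =>
    intro U B L k f hN h hstate
    rcases U.eq_empty_or_nonempty with rfl | hU
    · refine HasTransversal.of_card_le h.matching _ fun p hp => ?_
      rw [Finset.empty_union] at hp ⊢
      have := h.card_le p hp
      omega
    have hUpos : 0 < U.card := hU.card_pos
    -- a vertex with a long list is coloured last
    by_cases hlong : ∃ v ∈ U, (U.filter (J.Adj v)).card + B.card < (L v).card
    · obtain ⟨v, hv, hlt⟩ := hlong
      refine h.hasTransversal_of_erase hv hlt
        (ih _ _ _ _ f ?_ (h.erase v) (Or.inl ?_))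
      · have := Finset.card_erase_add_one hv
        omega
      -- In the second state the removed vertex has positive excess, which restores the bound `|B|`.
      · have h1 := sum_excess_erase_add_le (J := J) (B := B) (L := L) (k := k) hv
        rcases hstate with h2 | ⟨-, h2, h3, -⟩
        · omega
        · have := h3 v hv
          omega
    push Not at hlong
    have hex : ∀ v ∈ U, k ≤ excess J U B L k v := fun v hv => by
      have := hlong v hv
      unfold excess
      omega
    obtain ⟨v₁, hv₁⟩ := hU
    have hkpos : 1 ≤ k := by have := h.lt v₁ hv₁; omega
    have hsum : ∀ (b : P) (hb : b ∈ B) (x : X) (hx : x ∈ L b) (R : Finset P), R ⊆ U →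
        (∀ v ∈ R, ∀ y ∈ L v, ¬ H.Adj x y) →
        ∑ v ∈ U, excess J U (B.erase b) (after H L {x}) k v + R.card
          ≤ ∑ v ∈ U, excess J U B L k v := by
      intro b hb x hx R hR hmiss
      rw [Finset.card_eq_sum_ones, ← Finset.sum_sdiff hR, ← Finset.sum_sdiff hR, add_assoc,
        ← Finset.sum_add_distrib]
      refine add_le_add (Finset.sum_le_sum fun v hv => ?_) (Finset.sum_le_sum fun v hv => ?_)
      · exact h.excess_pick_le hb hx (Finset.mem_sdiff.1 hv).1
      · exact excess_pick_add_one_le hb (hmiss v hv) (hkpos.trans (hex v (hR hv)))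
    have hpick : ∀ (b : P) (hb : b ∈ B) (x : X) (hx : x ∈ L b),
        (∑ v ∈ U, excess J U (B.erase b) (after H L {x}) k v ≤ (B.erase b).card ∨
        (2 ≤ k ∧ ∑ v ∈ U, excess J U (B.erase b) (after H L {x}) k v ≤ (B.erase b).card + 1 ∧
          (∀ v ∈ U, 1 ≤ excess J U (B.erase b) (after H L {x}) k v) ∧
          ∃ b' ∈ B.erase b, ∃ x' ∈ after H L {x} b', ∃ v ∈ U, ∀ y ∈ after H L {x} v,
            ¬ H.Adj x' y)) → HasTransversal H L (U ∪ B) := by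
      intro b hb x hx hst
      refine h.hasTransversal_of_pick hb hx (ih _ _ _ _ f ?_ (h.pick hb hx) hst)
      have := Finset.card_erase_add_one hb
      omega
    -- the closed case and its opposite, when `x` misses at most the vertices in `R`
    have hmain : 2 ≤ k → ∀ (b : P) (hb : b ∈ B) (x : X) (hx : x ∈ L b) (R : Finset P), R ⊆ U →
        (∀ v ∈ R, ∀ y ∈ L v, ¬ H.Adj x y) → R.card ≤ 1 →
        (∀ v ∈ U, v ∉ R → ∃ y ∈ L v, H.Adj x y) →
        ∑ v ∈ U, excess J U B L k v ≤ B.card + R.card → HasTransversal H L (U ∪ B) := by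
      intro hk b hb x hx R hR hmiss hR1 hrow hD
      by_cases hcl : IsClosedAt H U B L b x
      -- With two colours available, some class avoids the at most one vertex that `x` misses.
      · obtain ⟨c, hck, hcR⟩ : ∃ c < k, ∀ v ∈ R, f v ≠ c := by
          rcases R.eq_empty_or_nonempty with rfl | ⟨r, hr⟩
          · exact ⟨0, by omega, by simp⟩
          · have hRr : ∀ v ∈ R, v = r := fun v hv => Finset.card_le_one.1 hR1 v hv r hr
            refine ⟨if f r = 0 then 1 else 0, by split_ifs <;> omega, fun v hv => ?_⟩
            rw [hRr v hv]
            split_ifs <;> omega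
        obtain ⟨L', f', h', he, ht⟩ := h.exists_class hb hx hcl hck
          (fun v hv hvc => hrow v hv fun hvR => hcR v hvR hvc)
        refine ht (ih _ _ _ _ f' ?_ h' (Or.inl ?_))
        · have := Finset.card_filter_le U (f · ≠ c)
          omega
        -- Every vertex of `U` contributes a drop of at least one, and `R.card ≤ U.card` absorbs the
        -- deficit.
        · have h1 : ∑ v ∈ U.filter (f · ≠ c), excess J (U.filter (f · ≠ c)) B L' (k - 1) v
              ≤ ∑ v ∈ U, (excess J U B L k v - 1) :=
            (Finset.sum_le_sum fun v hv => he v (Finset.mem_filter.1 hv).1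
              (Finset.mem_filter.1 hv).2).trans
              (Finset.sum_le_sum_of_subset (Finset.filter_subset _ _))
          have h2 : ∑ v ∈ U, (excess J U B L k v - 1) + U.card = ∑ v ∈ U, excess J U B L k v := by
            rw [Finset.card_eq_sum_ones, ← Finset.sum_add_distrib]
            refine Finset.sum_congr rfl fun v hv => ?_
            have := hex v hv
            omega
          omega
      -- After `x` is chosen, `w` survives, but its only neighbour `y` in `L v` is deleted: `w` now
      -- misses `v`.
      · unfold IsClosedAt at hcl
        push Not at hcl
        obtain ⟨c, hc, hcb, w, hw, v, hv, y, hy, hxy, hwy, hxw⟩ := hcl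
        refine hpick b hb x hx (Or.inr ⟨hk, ?_, ?_, c, Finset.mem_erase.2 ⟨hcb, hc⟩, w, ?_, v, hv,
          ?_⟩)
        · have := hsum b hb x hx R hR hmiss
          have := Finset.card_erase_add_one hb
          omega
        · intro v hv
          have := le_excess_pick (J := J) (U := U) (L := L) (k := k) (v := v) (H := H) (x := x) hb
          have := hex v hv
          omega
        · exact mem_after.2 ⟨hw, by simpa using hxw⟩
        · intro y' hy' hwy'
          have := h.matching c v (h.ne_of_mem hv hc).symm w hw y hy y' (after_subset _ _ hy') hwy
            hwy'
          subst this
          exact (mem_after.1 hy').2 x (Finset.mem_singleton_self x) hxy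
    rcases hstate with hD | ⟨hk, hD, -, b, hb, x, hx, v, hv, hxv⟩
    · by_cases hmiss : ∃ b ∈ B, ∃ x ∈ L b, ∃ v ∈ U, ∀ y ∈ L v, ¬ H.Adj x y
      · obtain ⟨b, hb, x, hx, v, hv, hxv⟩ := hmiss
        refine hpick b hb x hx (Or.inl ?_)
        have := hsum b hb x hx {v} (by simpa using hv) (by simpa using hxv)
        have := Finset.card_erase_add_one hb
        rw [Finset.card_singleton] at *
        omega
      · push Not at hmiss
        have hBpos : 0 < B.card := by
          have := Finset.single_le_sum (f := fun v => excess J U B L k v) (fun _ _ => Nat.zero_le _)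
            hv₁
          have := hex v₁ hv₁
          omega
        obtain ⟨b, hb⟩ := Finset.card_pos.1 hBpos
        have hcard := h.card_le b hb
        obtain ⟨x, hx⟩ : (L b).Nonempty := Finset.card_pos.1 (by omega)
        -- For `k = 1` the vertex `v₁` has degree zero, so its list has at most `|B|` elements; yet
        -- `L b`, with at least `|B| + 1` elements, is matched into it.
        have hk : 2 ≤ k := by
          by_contra hk
          have hdeg : (U.filter (J.Adj v₁)).card = 0 := by
            rw [Finset.card_eq_zero, Finset.filter_eq_empty_iff]
            intro u hu hadj
            have := h.ne v₁ hv₁ u hu hadj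
            have := h.lt u hu
            have := h.lt v₁ hv₁
            omega
          have hl := hlong v₁ hv₁
          choose! r hr hadj using fun x hx => hmiss b hb x hx v₁ hv₁
          have := Finset.card_le_card_of_injOn (s := L b) (t := L v₁) r hr (by
            intro z hz z' hz' he
            refine h.matching v₁ b (h.ne_of_mem hv₁ hb) (r z) (hr z hz) z hz z' hz'
              (hadj z hz).symm ?_
            rw [he]
            exact (hadj z' hz').symm)
          omega
        exact hmain hk b hb x hx ∅ (by simp) (by simp) (by simp)
          (fun v hv _ => hmiss b hb x hx v hv) (by simpa using hD)
    · by_cases hv' : ∃ v' ∈ U, v' ≠ v ∧ ∀ y ∈ L v', ¬ H.Adj x y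
      · obtain ⟨v', hv', hne, hxv'⟩ := hv'
        refine hpick b hb x hx (Or.inl ?_)
        have := hsum b hb x hx {v, v'} (by simp [Finset.insert_subset_iff, hv, hv'])
          (by simp only [Finset.mem_insert, Finset.mem_singleton]
              rintro _ (rfl | rfl)
              exacts [hxv, hxv'])
        have := Finset.card_erase_add_one hb
        rw [Finset.card_pair hne.symm] at *
        omega
      · push Not at hv'
        exact hmain hk b hb x hx {v} (by simpa using hv) (by simpa using hxv) (by simp)
          (fun u hu hne => hv' u hu (by simpa using hne)) (by simpa using hD)

/-- If the total excess of the lists on `U` is at most `|B|`, there is a transversal. -/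
theorem JoinLists.hasTransversal [Nonempty X] (h : JoinLists J H U B L k f)
    (hD : ∑ v ∈ U, excess J U B L k v ≤ B.card) : HasTransversal H L (U ∪ B) :=
  JoinLists.hasTransversal_aux _ U B L k f le_rfl h (Or.inl hD)

end Excess

/-! ### From covers to lists, and chromatic numbers of joins -/

section DPColorable

open Classical

variable {V : Type u} {G : SimpleGraph V}

/-- Independent choices exist for all lists of at least `t` elements that are joined by matchings
along the edges of `G`. -/
def ListDPColorable [Fintype V] (G : SimpleGraph V) (t : ℕ) : Prop :=
  ∀ (X : Type u) (H : SimpleGraph X) (L : V → Finset X), MatchingLists H L →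
    (∀ u v, u ≠ v → ¬ G.Adj u v → ∀ x ∈ L u, ∀ y ∈ L v, ¬ H.Adj x y) →
    (∀ v, t ≤ (L v).card) → Nonempty X → HasTransversal H L Finset.univ

lemma ListDPColorable.dpColorable [Fintype V] {t : ℕ} (h : ListDPColorable G t)
    (ht : IsEmpty V ∨ 0 < t) : DPColorable G t := by
  intro W C hC
  rcases isEmpty_or_nonempty V with hV | ⟨⟨v₀⟩⟩
  · exact ⟨∅, by simp, by simp⟩
  have ht : 0 < t := ht.resolve_left fun h => h.elim v₀
  have hfin : ∀ v, (C.L v).Finite := fun v =>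
    Set.finite_of_encard_eq_coe (hC v)
  have hcard : ∀ v, (hfin v).toFinset.card = t := fun v => by
    have := hC v
    rw [(hfin v).encard_eq_coe_toFinset_card] at this
    exact_mod_cast this
  have hX : Nonempty W := by
    obtain ⟨x, -⟩ := Finset.card_pos.1 ((hcard v₀).symm ▸ ht)
    exact ⟨x⟩
  have ht : HasTransversal C.H (fun v => (hfin v).toFinset) Finset.univ := by
    refine h W C.H _ ?_ ?_ (fun v => (hcard v).ge) hX
    · intro p q hpq x hx y hy y' hy' hxy hxy'
      simp only [Set.Finite.mem_toFinset] at hx hy hy'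
      by_cases hadj : G.Adj p q
      · exact C.matching p q hadj x hx y hy y' hy' hxy hxy'
      · exact absurd hxy (C.not_adj p q hpq hadj x hx y hy)
    · intro p q hpq hadj x hx y hy
      simp only [Set.Finite.mem_toFinset] at hx hy
      exact C.not_adj p q hpq hadj x hx y hy
  obtain ⟨φ, hφ, hind⟩ := ht
  simp only [Finset.mem_univ, Set.Finite.mem_toFinset, forall_const] at hφ hind
  have hinj : Function.Injective φ := by
    intro p q hpq
    by_contra hne
    exact Set.disjoint_left.1 (C.disjoint p q hne) (hφ p) (hpq ▸ hφ q)
  refine ⟨Set.range φ, ?_, ?_⟩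
  · rintro _ ⟨p, rfl⟩ _ ⟨q, rfl⟩ hne
    exact hind p q fun e => hne (e ▸ rfl)
  · rw [← Set.image_univ, hinj.injOn.encard_image, Set.encard_univ]
    simp

/-- Each `L v` is a clique, so an independent set meets it at most once; having `|V|` elements, it
meets each exactly once. -/
lemma Cover.IsColorable.exists_choice [Fintype V] {W : Type*} {C : Cover G W}
    (h : C.IsColorable) :
    ∃ φ : V → W, (∀ v, φ v ∈ C.L v) ∧ ∀ u v, u ≠ v → ¬ C.H.Adj (φ u) (φ v) := by
  obtain ⟨I, hI, hcard⟩ := h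
  have hex : ∀ w : W, ∃ v, w ∈ C.L v := fun w => by
    have := Set.mem_univ w
    rwa [← C.iUnion_eq, Set.mem_iUnion] at this
  choose r hr using hex
  have hinj : Set.InjOn r I := by
    intro x hx y hy hxy
    by_contra hne
    exact hI hx hy hne (C.isClique (r x) (hr x) (by rw [hxy]; exact hr y) hne)
  have himg : r '' I = Set.univ := by
    refine Set.Finite.eq_of_subset_of_encard_le (Set.toFinite _) (Set.subset_univ _) ?_
    rw [hinj.encard_image, hcard, Set.encard_univ]
    simp
  have : ∀ v, ∃ w ∈ I, r w = v := fun v => by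
    have := Set.mem_univ v
    rwa [← himg] at this
  choose φ hφ hrφ using this
  have hmem : ∀ v, φ v ∈ C.L v := fun v => by
    have := hr (φ v)
    rwa [hrφ] at this
  refine ⟨φ, hmem, fun u v huv => hI (hφ u) (hφ v) fun e => huv ?_⟩
  rw [← hrφ u, ← hrφ v, e]

/-- The `m`-fold cover given by a permutation for each edge. -/
def permCover (G : SimpleGraph V) (m : ℕ) (σ : V → V → Equiv.Perm (Fin m))
    (hσ : ∀ u v, σ v u = (σ u v)⁻¹) : Cover G (V × Fin m) where
  H :=
    { Adj := fun x y => (x.1 = y.1 ∧ x.2 ≠ y.2) ∨ (G.Adj x.1 y.1 ∧ σ x.1 y.1 x.2 = y.2)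
      symm := ⟨by
        rintro x y (⟨h1, h2⟩ | ⟨h1, h2⟩)
        · exact Or.inl ⟨h1.symm, h2.symm⟩
        · refine Or.inr ⟨h1.symm, ?_⟩
          rw [hσ x.1 y.1, ← h2]; simp⟩
      loopless := ⟨by
        rintro x (⟨-, h⟩ | ⟨h, -⟩)
        · exact h rfl
        · exact G.loopless.irrefl _ h⟩ }
  L := fun v => {x | x.1 = v}
  disjoint := fun u v huv => Set.disjoint_left.2 fun x hx hx' => huv (hx.symm.trans hx')
  iUnion_eq := by
    ext x
    simp
  isClique := by
    rintro v x rfl y hy hxy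
    exact Or.inl ⟨Eq.symm hy, fun e => hxy (Prod.ext (Eq.symm hy) e)⟩
  not_adj := by
    rintro u v huv hadj x rfl y rfl (⟨h, -⟩ | ⟨h, -⟩)
    · exact huv h
    · exact hadj h
  matching := by
    rintro u v huv x rfl y rfl y' hy' (⟨h1, -⟩ | ⟨-, h1⟩) (⟨h2, -⟩ | ⟨-, h2⟩)
    · exact absurd h1 huv.ne
    · exact absurd h1 huv.ne
    · exact absurd (h2.trans hy') huv.ne
    · refine Prod.ext (Eq.symm hy') ?_
      rw [← h1, ← h2, show y'.1 = y.1 from hy']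

lemma permCover_isFold (m : ℕ) (σ : V → V → Equiv.Perm (Fin m)) (hσ : ∀ u v, σ v u = (σ u v)⁻¹) :
    (permCover G m σ hσ).IsFold m := by
  intro v
  have : (permCover G m σ hσ).L v = (fun i => (v, i)) '' (Set.univ : Set (Fin m)) := by
    ext ⟨a, i⟩
    simp [permCover, eq_comm]
  rw [this, Function.Injective.encard_image (Prod.mk_right_injective v), Set.encard_univ]
  simp

lemma DPColorable.exists_permCover_choice [Fintype V] {m : ℕ} (h : DPColorable G m)
    (σ : V → V → Equiv.Perm (Fin m)) (hσ : ∀ u v, σ v u = (σ u v)⁻¹) :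
    ∃ c : V → Fin m, ∀ u v, G.Adj u v → σ u v (c u) ≠ c v := by
  obtain ⟨φ, hφ, hind⟩ := (h _ _ (permCover_isFold m σ hσ)).exists_choice
  refine ⟨fun v => (φ v).2, fun u v huv he => hind u v huv.ne (Or.inr ?_)⟩
  have hu : (φ u).1 = u := hφ u
  have hv : (φ v).1 = v := hφ v
  rw [hu, hv]
  exact ⟨huv, he⟩

lemma DPColorable.colorable [Fintype V] {m : ℕ} (h : DPColorable G m) : G.Colorable m := by
  obtain ⟨c, hc⟩ := h.exists_permCover_choice (fun _ _ => 1) (by simp)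
  exact ⟨SimpleGraph.Coloring.mk c fun {u v} huv => by simpa using hc u v huv⟩

lemma chromaticNumber_le_dpChromaticNumber [Fintype V] :
    G.chromaticNumber ≤ dpChromaticNumber G :=
  le_iInf₂ fun _ hm => (DPColorable.colorable hm).chromaticNumber_le

lemma dpChromaticNumber_eq [Fintype V] {t : ℕ} (h : DPColorable G t)
    (ht : (t : ℕ∞) ≤ G.chromaticNumber) : dpChromaticNumber G = G.chromaticNumber :=
  le_antisymm ((iInf₂_le t h).trans ht) chromaticNumber_le_dpChromaticNumber

@[simp] lemma join_adj_inl_inl {W : Type*} {K : SimpleGraph W} {u v : V} :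
    (join G K).Adj (Sum.inl u) (Sum.inl v) ↔ G.Adj u v := by
  simp [join]

@[simp] lemma join_adj_inr_inr {W : Type*} {K : SimpleGraph W} {u v : W} :
    (join G K).Adj (Sum.inr u) (Sum.inr v) ↔ K.Adj u v := by
  simp [join]

@[simp] lemma join_adj_inl_inr {W : Type*} {K : SimpleGraph W} {u : V} {v : W} :
    (join G K).Adj (Sum.inl u) (Sum.inr v) := by
  simp [join]

@[simp] lemma join_adj_inr_inl {W : Type*} {K : SimpleGraph W} {u : V} {v : W} :
    (join G K).Adj (Sum.inr v) (Sum.inl u) := by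
  simp [join]

/-- The clique uses `s` distinct colours, none of which occurs on `G`. -/
lemma add_le_chromaticNumber_join {k s : ℕ} (hk : G.chromaticNumber = k) :
    ((k + s : ℕ) : ℕ∞) ≤ (join G (⊤ : SimpleGraph (Fin s))).chromaticNumber := by
  refine le_iInf₂ fun c hc => ?_
  obtain ⟨C⟩ := hc
  set R : Finset (Fin c) := Finset.univ.image fun i : Fin s => C (Sum.inr i) with hR
  have hRcard : R.card = s := by
    rw [hR, Finset.card_image_of_injective _ ?_, Finset.card_fin]
    intro i j hij
    by_contra hne
    exact C.valid (v := Sum.inr i) (w := Sum.inr j) (by simpa using hne) hij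
  have hcol : G.Colorable (Fintype.card {x : Fin c // x ∉ R}) := by
    refine SimpleGraph.Coloring.colorable (α := {x : Fin c // x ∉ R})
      (SimpleGraph.Coloring.mk (fun v => ⟨C (Sum.inl v), ?_⟩) ?_)
    · intro h
      obtain ⟨i, -, hi⟩ := Finset.mem_image.1 h
      exact C.valid (v := Sum.inr i) (w := Sum.inl v) (by simp) hi
    · intro u v huv e
      exact C.valid (v := Sum.inl u) (w := Sum.inl v) (by simpa using huv) (congrArg Subtype.val e)
  have h1 := hcol.chromaticNumber_le
  rw [hk] at h1
  have h2 : k ≤ Fintype.card {x : Fin c // x ∉ R} := by exact_mod_cast h1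
  have h3 : Fintype.card {x : Fin c // x ∉ R} = c - s := by
    rw [Fintype.card_subtype_compl, Fintype.card_fin, Fintype.card_coe, hRcard]
  have h4 : s ≤ c := by
    rw [← hRcard]
    simpa using Finset.card_le_univ R
  have : k + s ≤ c := by omega
  exact_mod_cast this

lemma colorable_join {k s : ℕ} (h : G.Colorable k) :
    (join G (⊤ : SimpleGraph (Fin s))).Colorable (k + s) := by
  obtain ⟨C⟩ := h
  refine ⟨SimpleGraph.Coloring.mk
    (Sum.elim (fun v => Fin.castAdd s (C v)) (fun i => Fin.natAdd k i)) ?_⟩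
  rintro (u | i) (v | j) h e
  · simp only [Sum.elim_inl, Fin.castAdd_inj] at e
    exact C.valid (by simpa using h) e
  · have := congrArg Fin.val e
    simp at this
    omega
  · have := congrArg Fin.val e
    simp at this
    omega
  · simp only [Sum.elim_inr, Fin.natAdd_inj] at e
    simp [e] at h

lemma ZDP_le [Fintype V] {k s : ℕ} (hk : G.chromaticNumber = k)
    (h : DPColorable (join G (⊤ : SimpleGraph (Fin s))) (k + s)) : ZDP G ≤ s :=
  iInf₂_le s (dpChromaticNumber_eq h (add_le_chromaticNumber_join hk))

/-- `2 |E(G)|` additional vertices suffice. -/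
theorem listDPColorable_join [Fintype V] [Fintype G.edgeSet] {k : ℕ} (hk : G.Colorable k) :
    ListDPColorable (join G (⊤ : SimpleGraph (Fin (2 * G.edgeFinset.card))))
      (k + 2 * G.edgeFinset.card) := by
  obtain ⟨C⟩ := hk
  set s := 2 * G.edgeFinset.card with hs
  intro X H L hL hnon hcard hX
  set U : Finset (V ⊕ Fin s) := Finset.univ.map Function.Embedding.inl with hU
  set B : Finset (V ⊕ Fin s) := Finset.univ.map Function.Embedding.inr with hB
  have hBc : B.card = s := by simp [hB]
  have hUB : ∀ p, p ∈ U ∪ B := by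
    rintro (p | p) <;> simp [hU, hB]
  have hJ : JoinLists (join G (⊤ : SimpleGraph (Fin s))) H U B L k
      (Sum.elim (fun v => (C v : ℕ)) 0) := by
    refine ⟨?_, hL, fun u _ v _ => hnon u v, ?_, ?_, ?_⟩
    · rw [Finset.disjoint_left]
      rintro (p | p) <;> simp [hU, hB]
    · rintro (p | p) <;> simp [hU]
    · rintro (p | p) hp (q | q) hq hpq
      · simpa [Fin.val_inj] using C.valid (by simpa using hpq)
      all_goals simp [hU] at hp hq
    · intro b _
      have := hcard b
      omega
  refine HasTransversal.mono (hJ.hasTransversal ?_) fun p _ => by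
    simpa using hUB p
  have hdeg : ∀ v : V, (U.filter ((join G (⊤ : SimpleGraph (Fin s))).Adj (Sum.inl v))).card
      = G.degree v := by
    intro v
    rw [← SimpleGraph.card_neighborFinset_eq_degree]
    refine Eq.trans (congrArg Finset.card (Finset.ext ?_))
      (Finset.card_map (s := G.neighborFinset v) (Function.Embedding.inl : V ↪ V ⊕ Fin s))
    rintro (p | p) <;> simp [hU]
  calc ∑ v ∈ U, excess (join G ⊤) U B L k v
      = ∑ v : V, excess (join G ⊤) U B L k (Sum.inl v) := by rw [hU, Finset.sum_map]; rfl
    _ ≤ ∑ v : V, G.degree v := by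
        refine Finset.sum_le_sum fun v _ => ?_
        have h1 := hcard (Sum.inl v)
        have h2 := hdeg v
        unfold excess
        omega
    _ = B.card := by
        rw [hBc, G.sum_degrees_eq_twice_card_edges, hs]
        congr!

end DPColorable

/-! ### Graphs with at most `t + 2` vertices -/

section SmallComplement

open Classical

variable {P X : Type*} {H : SimpleGraph X} {L : P → Finset X}

/-- With the empty graph on `S` and `k = 1`, all excesses vanish. -/
lemma JoinLists.hasTransversal_of_indep [Nonempty X] (hL : MatchingLists H L) {S B : Finset P}
    (hd : Disjoint S B)
    (hS : ∀ p ∈ S, ∀ q ∈ S, p ≠ q → ∀ x ∈ L p, ∀ y ∈ L q, ¬ H.Adj x y)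
    (hcard : ∀ p ∈ S ∪ B, B.card + 1 ≤ (L p).card) : HasTransversal H L (S ∪ B) := by
  have hJ : JoinLists (⊥ : SimpleGraph P) H S B L 1 0 :=
    { disj := hd
      matching := hL
      nonadj := fun p hp q hq hpq _ => hS p hp q hq hpq
      lt := by simp
      ne := by simp
      card_le := fun b hb => hcard b (Finset.mem_union_right _ hb) }
  refine hJ.hasTransversal ?_
  rw [Finset.sum_eq_zero]
  · exact Nat.zero_le _
  · intro v hv
    have := hcard v (Finset.mem_union_left _ hv)
    simp only [excess, SimpleGraph.bot_adj, Finset.filter_false, Finset.card_empty]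
    omega

/-- The lists of `p` and `q` are not joined by edges. -/
def NoEdges (H : SimpleGraph X) (L : P → Finset X) (p q : P) : Prop :=
  ∀ x ∈ L p, ∀ y ∈ L q, ¬ H.Adj x y

lemma NoEdges.symm {p q : P} (h : NoEdges H L p q) : NoEdges H L q p :=
  fun x hx y hy hxy => h y hy x hx hxy.symm

lemma NoEdges.after {p q : P} (h : NoEdges H L p q) (C : Finset X) :
    NoEdges H (after H L C) p q :=
  fun x hx y hy => h x (after_subset _ _ hx) y (after_subset _ _ hy)

/-- Greedy in the order `B`, `v'`, `u'`, `v`, `u`: each of the last four sees at most one of the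
others coloured before it. -/
lemma hasTransversal_path [Nonempty X] (hL : MatchingLists H L) {B : Finset P} {u u' v v' : P}
    (hu : u ∉ B) (hu' : u' ∉ B) (hv : v ∉ B) (hv' : v' ∉ B) (h1 : u ≠ u') (h2 : v ≠ v')
    (h3 : u ≠ v) (h4 : u ≠ v') (h5 : u' ≠ v) (h6 : u' ≠ v')
    (e1 : NoEdges H L u u') (e2 : NoEdges H L v v') (e3 : NoEdges H L u v)
    (hB : ∀ b ∈ B, B.card ≤ (L b).card)
    (cu : B.card + 2 ≤ (L u).card) (cu' : B.card + 2 ≤ (L u').card)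
    (cv : B.card + 2 ≤ (L v).card) (cv' : B.card + 2 ≤ (L v').card) :
    HasTransversal H L (insert u (insert v (insert u' (insert v' B)))) := by
  have hc : ∀ p, (insert p B).card ≤ B.card + 1 := fun p => Finset.card_insert_le _ _
  have t1 := (HasTransversal.of_card_le hL B hB).insert_last hL hv' (N := B)
    (fun q hq hn => absurd hq hn) (by omega)
  have t2 := t1.insert_last hL (v := u') (N := insert v' B) (by simp [hu', h6])
    (fun q hq hn => absurd hq hn) (by have := hc v'; omega)
  have t3 := t2.insert_last hL (v := v) (N := insert u' B) (by simp [hv, h2, h5.symm])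
    (by
      intro q hq hn
      have : q = v' := by
        simp only [Finset.mem_insert, not_or] at hq hn
        tauto
      subst this
      exact e2.symm) (by have := hc u'; omega)
  refine t3.insert_last hL (v := u) (N := insert v' B) (by simp [hu, h1, h3, h4]) ?_
    (by have := hc v'; omega)
  intro q hq hn
  simp only [Finset.mem_insert, not_or] at hq hn
  rcases hq with rfl | rfl | hq
  · exact e3.symm
  · exact e1.symm
  · tauto

/-- Greedy in the order `v'`, `u'`, `v`, `u`; only `u` sees two earlier vertices, and its list is
the long one. -/
lemma hasTransversal_fourCycle_of_long [Nonempty X] (hL : MatchingLists H L) {u u' v v' : P}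
    (h1 : u ≠ u') (h2 : v ≠ v') (h3 : u ≠ v) (h4 : u ≠ v') (h5 : u' ≠ v) (h6 : u' ≠ v')
    (e1 : NoEdges H L u u') (e2 : NoEdges H L v v')
    (cu : 3 ≤ (L u).card) (cu' : 2 ≤ (L u').card) (cv : 2 ≤ (L v).card) (cv' : 2 ≤ (L v').card) :
    HasTransversal H L {u, v, u', v'} := by
  have t0 : HasTransversal H L ∅ := HasTransversal.of_card_le hL ∅ (by simp)
  have t1 := t0.insert_last hL (v := v') (N := ∅) (by simp) (by simp)
    (by rw [Finset.card_empty]; omega)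
  have t2 := t1.insert_last hL (v := u') (N := {v'}) (by simp [h6])
    (fun q hq hn => absurd (by simpa using hq) hn) (by simp; omega)
  have t3 := t2.insert_last hL (v := v) (N := {u'}) (by simp [h2, h5.symm])
    (by
      intro q hq hn
      have : q = v' := by
        simp only [Finset.mem_insert, Finset.mem_singleton, Finset.notMem_empty] at hq hn
        tauto
      subst this
      exact e2.symm) (by simp; omega)
  refine (t3.insert_last hL (v := u) (N := {v, v'}) (by simp [h1, h3, h4]) ?_ ?_).mono ?_
  · intro q hq hn
    have : q = u' := by
      simp only [Finset.mem_insert, Finset.mem_singleton, Finset.notMem_empty] at hq hn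
      tauto
    subst this
    exact e1.symm
  · rw [Finset.card_pair h2]
    omega
  · simp

lemma hasTransversal_path_three [Nonempty X] (hL : MatchingLists H L) {u' v v' : P}
    (h2 : v ≠ v') (h5 : u' ≠ v) (h6 : u' ≠ v') (e2 : NoEdges H L v v')
    (cu' : 2 ≤ (L u').card) (cv : 2 ≤ (L v).card) (cv' : 1 ≤ (L v').card) :
    HasTransversal H L {v, u', v'} := by
  have t0 : HasTransversal H L ∅ := HasTransversal.of_card_le hL ∅ (by simp)
  have t1 := t0.insert_last hL (v := v') (N := ∅) (by simp) (by simp)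
    (by rw [Finset.card_empty]; omega)
  have t2 := t1.insert_last hL (v := u') (N := {v'}) (by simp [h6])
    (fun q hq hn => absurd (by simpa using hq) hn) (by simp; omega)
  refine (t2.insert_last hL (v := v) (N := {u'}) (by simp [h2, h5.symm]) ?_ (by simp; omega)).mono
    (by simp)
  intro q hq hn
  have : q = v' := by
    simp only [Finset.mem_insert, Finset.mem_singleton, Finset.notMem_empty] at hq hn
    tauto
  subst this
  exact e2.symm

/-- The wheel with four spokes and lists of three elements. -/
lemma hasTransversal_wheel [Nonempty X] (hL : MatchingLists H L) {a u u' v v' : P}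
    (h1 : u ≠ u') (h2 : v ≠ v') (h3 : u ≠ v) (h4 : u ≠ v') (h5 : u' ≠ v) (h6 : u' ≠ v')
    (au : a ≠ u) (au' : a ≠ u') (av : a ≠ v) (av' : a ≠ v')
    (e1 : NoEdges H L u u') (e2 : NoEdges H L v v')
    (ca : 3 ≤ (L a).card) (cu : 3 ≤ (L u).card) (cu' : 3 ≤ (L u').card)
    (cv : 3 ≤ (L v).card) (cv' : 3 ≤ (L v').card) :
    HasTransversal H L {a, u, v, u', v'} := by
  by_contra hno
  have hdrop : ∀ x ∈ L a, ∀ p, p ≠ a → 3 ≤ (L p).card → 2 ≤ (after H L {x} p).card := by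
    intro x hx p hp hc
    have := card_le_card_after_singleton hL hp hx
    omega
  -- If `x` missed the list of a rim vertex, that list would keep three elements and the rim could
  -- be coloured.
  have long : ∀ p p' q q' : P, p ≠ p' → q ≠ q' → p ≠ q → p ≠ q' → p' ≠ q → p' ≠ q' → a ≠ p →
      a ≠ p' → a ≠ q → a ≠ q' → NoEdges H L p p' → NoEdges H L q q' → 3 ≤ (L p).card →
      3 ≤ (L p').card → 3 ≤ (L q).card → 3 ≤ (L q').card →
      (∀ r ∈ ({a, u, v, u', v'} : Finset P), r ∈ ({a, p, q, p', q'} : Finset P)) →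
      ∀ x ∈ L a, ∃ y ∈ L p, H.Adj x y := by
    intro p p' q q' n1 n2 n3 n4 n5 n6 ap ap' aq aq' f1 f2 cp cp' cq cq' hset x hx
    by_contra! hmiss
    refine hno (HasTransversal.mono (HasTransversal.of_after_singleton (b := a) (by simp [*]) hx
      (hasTransversal_fourCycle_of_long (hL.after {x}) n1 n2 n3 n4 n5 n6 (f1.after _) (f2.after _)
      ?_ (hdrop x hx p' ap'.symm cp') (hdrop x hx q aq.symm cq) (hdrop x hx q' aq'.symm cq'))) hset)
    rwa [after_singleton_eq hmiss]
  -- Otherwise `x` and `y` could both be chosen without shrinking `L q` twice, and the path `q`,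
  -- `p'`, `q'` could be finished greedily.
  have edge : ∀ p p' q q' : P, p ≠ p' → q ≠ q' → p ≠ q → p ≠ q' → p' ≠ q → p' ≠ q' → a ≠ p →
      a ≠ p' → a ≠ q → a ≠ q' → NoEdges H L p p' → NoEdges H L q q' → 3 ≤ (L p).card →
      3 ≤ (L p').card → 3 ≤ (L q).card → 3 ≤ (L q').card →
      (∀ r ∈ ({a, u, v, u', v'} : Finset P), r ∈ ({a, p, q, p', q'} : Finset P)) →
      ∀ x ∈ L a, ∀ y ∈ L p, ¬ H.Adj x y → ∃ z ∈ L q, H.Adj y z ∧ ¬ H.Adj x z := by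
    intro p p' q q' n1 n2 n3 n4 n5 n6 ap ap' aq aq' f1 f2 cp cp' cq cq' hset x hx y hy hxy
    by_contra! hmiss
    have hy' : y ∈ after H L {x} p := mem_after.2 ⟨hy, by simpa using hxy⟩
    have hmiss' : ∀ z ∈ after H L {x} q, ¬ H.Adj y z := fun z hz hyz =>
      (mem_after.1 hz).2 x (by simp) (hmiss z (mem_after.1 hz).1 hyz)
    have d1 := hdrop x hx p' ap'.symm cp'
    have d2 := hdrop x hx q aq.symm cq
    have d3 := hdrop x hx q' aq'.symm cq'
    refine hno (HasTransversal.mono (HasTransversal.of_after_singleton (b := a) (by simp [*]) hx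
      (HasTransversal.of_after_singleton (b := p) (by simp [*]) hy'
      (hasTransversal_path_three ((hL.after {x}).after {y}) n2 n5 n6 ((f2.after _).after _)
      ?_ ?_ ?_))) hset)
    · rw [after_singleton_eq]
      · exact d1
      · exact fun z hz => (f1.after {x}) y hy' z hz
    · rwa [after_singleton_eq hmiss']
    · have := card_le_card_after_singleton (hL.after {x}) n4.symm hy'
      omega
  have ru := long u u' v v' h1 h2 h3 h4 h5 h6 au au' av av' e1 e2 cu cu' cv cv' (by simp)
  have ru' := long u' u v v' h1.symm h2 h5 h6 h3 h4 au' au av av' e1.symm e2 cu' cu cv cv'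
    (by simp)
  have rv := long v v' u u' h2 h1 h3.symm h5.symm h4.symm h6.symm av av' au au' e2 e1 cv cv' cu cu'
    (by simp)
  have rv' := long v' v u u' h2.symm h1 h4.symm h6.symm h3.symm h5.symm av' av au au' e2.symm e1
    cv' cv cu cu' (by simp)
  have duv := edge u u' v v' h1 h2 h3 h4 h5 h6 au au' av av' e1 e2 cu cu' cv cv' (by simp)
  have duv' := edge u u' v' v h1 h2.symm h4 h3 h6 h5 au au' av' av e1 e2.symm cu cu' cv' cv
    (by simp)
  have du'v := edge u' u v v' h1.symm h2 h5 h6 h3 h4 au' au av av' e1.symm e2 cu' cu cv cv'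
    (by simp)
  have du'v' := edge u' u v' v h1.symm h2.symm h6 h5 h4 h3 au' au av' av e1.symm e2.symm cu' cu cv'
    cv (by simp)
  -- Take neighbours of `x₂` in the lists of `u`, `u'` and of `x₃` in those of `v`, `v'`. With `x₁`
  -- they turn out to be independent, a contradiction.
  obtain ⟨x₁, hx₁, x₂, hx₂, x₃, hx₃, h12, h13, h23⟩ := Finset.two_lt_card.1 ca
  obtain ⟨y, hy, hxy⟩ := ru x₂ hx₂
  obtain ⟨y', hy', hxy'⟩ := ru' x₂ hx₂
  obtain ⟨z, hz, hxz⟩ := rv x₃ hx₃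
  obtain ⟨z', hz', hxz'⟩ := rv' x₃ hx₃
  have uniq : ∀ p, a ≠ p → ∀ w ∈ L p, ∀ x ∈ L a, ∀ x' ∈ L a, H.Adj x w → x ≠ x' → ¬ H.Adj x' w :=
    fun p hp w hw x hx x' hx' h hne h' => hne (hL p a hp.symm w hw x hx x' hx' h.symm h'.symm)
  -- By `edge`, the only neighbour of `y` in `L q` is not adjacent to `x₃`, so it is not `z`.
  have cross : ∀ q, a ≠ q → ∀ p, p ≠ q → ∀ y ∈ L p, ∀ z ∈ L q, H.Adj x₃ z →
      (∃ w ∈ L q, H.Adj y w ∧ ¬ H.Adj x₃ w) → ¬ H.Adj y z := by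
    rintro q haq p hpq y hy z hz h ⟨w, hw, hyw, hn⟩ hyz
    rw [hL p q hpq y hy w hw z hz hyw hyz] at hn
    exact hn h
  have c1 := cross v av u h3 y hy z hz hxz (duv x₃ hx₃ y hy (uniq u au y hy x₂ hx₂ x₃ hx₃ hxy h23))
  have c2 := cross v' av' u h4 y hy z' hz' hxz'
    (duv' x₃ hx₃ y hy (uniq u au y hy x₂ hx₂ x₃ hx₃ hxy h23))
  have c3 := cross v av u' h5 y' hy' z hz hxz
    (du'v x₃ hx₃ y' hy' (uniq u' au' y' hy' x₂ hx₂ x₃ hx₃ hxy' h23))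
  have c4 := cross v' av' u' h6 y' hy' z' hz' hxz'
    (du'v' x₃ hx₃ y' hy' (uniq u' au' y' hy' x₂ hx₂ x₃ hx₃ hxy' h23))
  have k1 := uniq u au y hy x₂ hx₂ x₁ hx₁ hxy h12.symm
  have k2 := uniq u' au' y' hy' x₂ hx₂ x₁ hx₁ hxy' h12.symm
  have k3 := uniq v av z hz x₃ hx₃ x₁ hx₁ hxz h13.symm
  have k4 := uniq v' av' z' hz' x₃ hx₃ x₁ hx₁ hxz' h13.symm
  have f1 := e1 y hy y' hy'
  have f2 := e2 z hz z' hz'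
  refine hno ⟨fun p => if p = a then x₁ else if p = u then y else if p = u' then y' else
    if p = v then z else z', ?_, ?_⟩
  · intro p hp
    simp only [Finset.mem_insert, Finset.mem_singleton] at hp
    rcases hp with rfl | rfl | rfl | rfl | rfl
    · simpa using hx₁
    · simpa [au.symm] using hy
    · simpa [av.symm, h3.symm, h5.symm] using hz
    · simpa [au'.symm, h1.symm] using hy'
    · simpa [av'.symm, h4.symm, h6.symm, h2.symm] using hz'
  · intro p hp q hq hpq
    simp only [Finset.mem_insert, Finset.mem_singleton] at hp hq
    rcases hp with rfl | rfl | rfl | rfl | rfl <;> rcases hq with rfl | rfl | rfl | rfl | rfl <;>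
      first
      | exact absurd rfl hpq
      | simp only [au.symm, av.symm, h3.symm, h5.symm, au'.symm, h1.symm, av'.symm, h4.symm,
          h6.symm, h2.symm, if_true, if_false]
        first
        | assumption
        | rw [H.adj_comm]; assumption

/-- Each vertex of `B` coloured first costs every other list at most one element, leaving three on
the wheel. -/
lemma hasTransversal_wheel_join [Nonempty X] {a u u' v v' : P}
    (h1 : u ≠ u') (h2 : v ≠ v') (h3 : u ≠ v) (h4 : u ≠ v') (h5 : u' ≠ v) (h6 : u' ≠ v')
    (au : a ≠ u) (au' : a ≠ u') (av : a ≠ v) (av' : a ≠ v') (B : Finset P) :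
    ∀ L : P → Finset X, MatchingLists H L → NoEdges H L u u' → NoEdges H L v v' →
    (∀ p ∈ ({a, u, v, u', v'} : Finset P), p ∉ B) →
    (∀ p ∈ {a, u, v, u', v'} ∪ B, B.card + 3 ≤ (L p).card) →
    HasTransversal H L ({a, u, v, u', v'} ∪ B) := by
  induction B using Finset.induction_on with
  | empty =>
    intro L hL e1 e2 _ hc
    rw [Finset.union_empty]
    apply hasTransversal_wheel hL <;> first | assumption | simpa using hc _ (by simp)
  | insert b B hb ih =>
    intro L hL e1 e2 hd hc
    have hcb := hc b (by simp)
    obtain ⟨x, hx⟩ : (L b).Nonempty := Finset.card_pos.1 (by omega)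
    have hbn : b ∉ ({a, u, v, u', v'} : Finset P) := fun h => hd b h (Finset.mem_insert_self _ _)
    rw [Finset.union_insert]
    refine HasTransversal.of_after_singleton ?_ hx (ih _ (hL.after _) (e1.after _) (e2.after _)
      (fun p hp hpB => hd p hp (Finset.mem_insert_of_mem hpB)) ?_)
    · rw [Finset.mem_union, not_or]
      exact ⟨hbn, hb⟩
    · intro p hp
      have hpb : p ≠ b := by
        rintro rfl
        rcases Finset.mem_union.1 hp with hp | hp
        · exact hbn hp
        · exact hb hp
      have := card_le_card_after_singleton hL hpb hx
      have := hc p (by rw [Finset.union_insert]; exact Finset.mem_insert_of_mem hp)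
      rw [Finset.card_insert_of_notMem hb] at this
      omega

lemma nonempty_iso_cycleGraph_four {V : Type*} [Fintype V] {G : SimpleGraph V} {u u' v v' : V}
    (hc : Fintype.card V = 4) (h1 : u ≠ u') (h2 : v ≠ v') (a1 : G.Adj u v) (a2 : G.Adj u v')
    (a3 : G.Adj u' v) (a4 : G.Adj u' v') (b1 : ¬ G.Adj u u') (b2 : ¬ G.Adj v v') :
    Nonempty (G ≃g SimpleGraph.cycleGraph 4) := by
  have hinj : Function.Injective ![u, v, u', v'] := by
    intro i j
    revert i j
    simp [Fin.forall_fin_succ, h1, h2, h1.symm, h2.symm, a1.ne, a2.ne, a3.ne, a4.ne, a1.ne.symm,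
      a2.ne.symm, a3.ne.symm, a4.ne.symm]
  have hbij : Function.Bijective ![u, v, u', v'] :=
    (Fintype.bijective_iff_injective_and_card _).2 ⟨hinj, by rw [Fintype.card_fin, hc]⟩
  refine ⟨RelIso.symm ⟨Equiv.ofBijective _ hbij, ?_⟩⟩
  intro i j
  revert i j
  simp only [Equiv.ofBijective_apply, SimpleGraph.cycleGraph_adj]
  simp [Fin.forall_fin_succ, a1, a2, a3, a4, b1, b2, a1.symm, a2.symm, a3.symm, a4.symm,
    G.adj_comm u' u, G.adj_comm v' v]
  decide

/-- A graph on at most `t + 2` vertices that has a proper `t`-colouring and is not a four-cycle. -/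
theorem listDPColorable_of_card_le {V : Type u} [Fintype V] {G : SimpleGraph V} {t : ℕ}
    (hG : G.Colorable t) (hcard : Fintype.card V ≤ t + 2)
    (hC : ¬ Nonempty (G ≃g SimpleGraph.cycleGraph 4)) : ListDPColorable G t := by
  intro X H L hL hnon hLt hX
  obtain ⟨C⟩ := hG
  have hno : ∀ u v, u ≠ v → C u = C v → NoEdges H L u v := fun u v huv hc =>
    hnon u v huv fun hadj => C.valid hadj hc
  by_cases hn : Fintype.card V ≤ t
  · exact HasTransversal.of_card_le hL _ fun p _ => by
      rw [Finset.card_univ]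
      exact hn.trans (hLt p)
  have hindep : ∀ S : Finset V, (∀ p ∈ S, ∀ q ∈ S, C p = C q) →
      Fintype.card V + 1 ≤ t + S.card → HasTransversal H L Finset.univ := by
    intro S hS hSc
    have hBc : (Finset.univ.filter (· ∉ S)).card + S.card = Fintype.card V := by
      rw [add_comm, ← Finset.card_univ,
        ← Finset.card_filter_add_card_filter_not (s := Finset.univ) (· ∈ S)]
      simp
    refine (JoinLists.hasTransversal_of_indep (S := S) (B := Finset.univ.filter (· ∉ S)) hL ?_ ?_
      ?_).mono ?_
    · rw [Finset.disjoint_left]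
      simp
    · exact fun p hp q hq hpq => hno p q hpq (hS p hp q hq)
    · intro p _
      have := hLt p
      omega
    · intro p _
      by_cases hp : p ∈ S <;> simp [hp]
  -- Pigeonhole, repeated below without `u`, yields two monochromatic pairs; if they overlap they
  -- form a monochromatic triple.
  obtain ⟨u, u', h1, hu⟩ := Fintype.exists_ne_map_eq_of_card_lt C (by simpa using hn)
  by_cases hn1 : Fintype.card V ≤ t + 1
  · refine hindep {u, u'} (by simp [hu]) ?_
    rw [Finset.card_pair h1]
    omega
  obtain ⟨v, hv, v', hv', h2, hvv⟩ := Finset.exists_ne_map_eq_of_card_lt_of_maps_to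
    (s := Finset.univ.erase u) (t := (Finset.univ : Finset (Fin t))) (f := C)
    (by rw [Finset.card_erase_of_mem (Finset.mem_univ _), Finset.card_univ, Finset.card_univ,
      Fintype.card_fin]; omega)
    (by simp)
  have h3 : u ≠ v := (Finset.ne_of_mem_erase hv).symm
  have h4 : u ≠ v' := (Finset.ne_of_mem_erase hv').symm
  have hthree : ∀ w, u ≠ w → u' ≠ w → C w = C u → HasTransversal H L Finset.univ := by
    intro w huw hu'w hw
    refine hindep {u, u', w} (by simp [hu, hw]) ?_
    rw [Finset.card_eq_three.2 ⟨u, u', w, h1, huw, hu'w, rfl⟩]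
    omega
  by_cases h5 : u' = v
  · exact hthree v' h4 (h5 ▸ h2) (by rw [← hvv, ← h5, hu])
  by_cases h6 : u' = v'
  · exact hthree v h3 (h6 ▸ h2.symm) (by rw [hvv, ← h6, hu])
  set F : Finset V := {u, v, u', v'} with hF
  have hFc : F.card = 4 := by
    rw [hF, Finset.card_insert_of_notMem (by simp [h1, h3, h4]),
      Finset.card_eq_three.2 ⟨v, u', v', Ne.symm h5, h2, h6, rfl⟩]
  set B : Finset V := Finset.univ.filter (· ∉ F) with hB
  have hBc : B.card + F.card = Fintype.card V := by
    rw [add_comm, ← Finset.card_univ,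
      ← Finset.card_filter_add_card_filter_not (s := Finset.univ) (· ∈ F)]
    simp [hB]
  have hpath : ∀ p p' q q' : V, p ≠ p' → q ≠ q' → p ≠ q → p ≠ q' → p' ≠ q → p' ≠ q' →
      C p = C p' → C q = C q' → (∀ r, r ∈ F ↔ r = p ∨ r = q ∨ r = p' ∨ r = q') → ¬ G.Adj p q →
      HasTransversal H L Finset.univ := by
    intro p p' q q' n1 n2 n3 n4 n5 n6 c1 c2 hset hpq
    have hFB : ∀ r ∈ F, r ∉ B := fun r hr hrB => (Finset.mem_filter.1 hrB).2 hr
    refine (hasTransversal_path hL (B := B) (hFB p ((hset p).2 (by simp)))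
      (hFB p' ((hset p').2 (by simp)))
      (hFB q ((hset q).2 (by simp))) (hFB q' ((hset q').2 (by simp))) n1 n2 n3 n4 n5 n6
      (hno p p' n1 c1) (hno q q' n2 c2) (hnon p q n3 hpq) ?_ ?_ ?_ ?_ ?_).mono ?_
    · intro b _
      have := hLt b
      omega
    · have := hLt p
      omega
    · have := hLt p'
      omega
    · have := hLt q
      omega
    · have := hLt q'
      omega
    · intro r _
      by_cases hr : r ∈ F
      · rcases (hset r).1 hr with rfl | rfl | rfl | rfl <;> simp
      · simp [hB, hr]
  by_cases a1 : G.Adj u v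
  swap
  · exact hpath u u' v v' h1 h2 h3 h4 h5 h6 hu hvv (by simp [hF]) a1
  by_cases a2 : G.Adj u v'
  swap
  · exact hpath u u' v' v h1 h2.symm h4 h3 h6 h5 hu hvv.symm (by simp [hF]; tauto) a2
  by_cases a3 : G.Adj u' v
  swap
  · exact hpath u' u v v' h1.symm h2 h5 h6 h3 h4 hu.symm hvv (by simp [hF]; tauto) a3
  by_cases a4 : G.Adj u' v'
  swap
  · exact hpath u' u v' v h1.symm h2.symm h6 h5 h4 h3 hu.symm hvv.symm (by simp [hF]; tauto) a4
  -- Now the two pairs span a four-cycle. It is all of `G`, or a further vertex serves as the hub of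
  -- a wheel.
  rcases B.eq_empty_or_nonempty with hB0 | ⟨a, ha⟩
  · exfalso
    rw [hB0, Finset.card_empty] at hBc
    exact hC (nonempty_iso_cycleGraph_four (by omega) h1 h2 a1 a2 a3 a4
      (fun h => C.valid h hu) (fun h => C.valid h hvv))
  · have haF : a ∉ F := (Finset.mem_filter.1 ha).2
    simp only [hF, Finset.mem_insert, Finset.mem_singleton, not_or] at haF
    obtain ⟨au, av, au', av'⟩ := haF
    have hBe := Finset.card_erase_add_one ha
    refine (hasTransversal_wheel_join h1 h2 h3 h4 h5 h6 au au' av av' (B.erase a) L hL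
      (hno u u' h1 hu) (hno v v' h2 hvv) ?_ ?_).mono ?_
    · intro p hp hpB
      have hpB' := Finset.mem_erase.1 hpB
      rcases Finset.mem_insert.1 hp with rfl | hp
      · exact hpB'.1 rfl
      · exact (Finset.mem_filter.1 hpB'.2).2 hp
    · intro p _
      have := hLt p
      omega
    · intro p _
      by_cases hp : p ∈ F
      · exact Finset.mem_union_left _ (Finset.mem_insert_of_mem hp)
      · by_cases hpa : p = a
        · simp [hpa]
        · exact Finset.mem_union_right _ (Finset.mem_erase.2 ⟨hpa, by simp [hB, hp]⟩)

end SmallComplement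

/-! ### The values of `Z_DP` -/

section Main

variable {V : Type u} {G : SimpleGraph V}

lemma ListDPColorable.of_colorable_one [Fintype V] (h : G.Colorable 1) : ListDPColorable G 1 := by
  intro X H L hL hnon hcard hX
  obtain ⟨C⟩ := h
  refine (JoinLists.hasTransversal_of_indep (S := Finset.univ) (B := ∅) hL (by simp) ?_ ?_).mono
    (by simp)
  · exact fun p _ q _ hpq => hnon p q hpq fun hadj => C.valid hadj (Subsingleton.elim _ _)
  · intro p _
    simpa using hcard p

/-- Joining the empty graph does not change a graph. -/
def joinFinZeroIso (G : SimpleGraph V) : join G (⊤ : SimpleGraph (Fin 0)) ≃g G where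
  toEquiv := Equiv.sumEmpty V (Fin 0)
  map_rel_iff' := by
    rintro (u | i) (v | j)
    · simp
    · exact j.elim0
    · exact i.elim0
    · exact i.elim0

lemma ZDP_eq_zero [Fintype V] {k : ℕ} (hk : G.chromaticNumber = k)
    (hkn : k ≤ 1 ∨ Fintype.card V ≤ k + 2)
    (hC : ¬ Nonempty (G ≃g SimpleGraph.cycleGraph 4)) : ZDP G = 0 := by
  have hcol : G.Colorable k := SimpleGraph.chromaticNumber_le_iff_colorable.1 hk.le
  have hcol' : (join G (⊤ : SimpleGraph (Fin 0))).Colorable k := colorable_join (s := 0) hcol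
  have hV : IsEmpty V ∨ 0 < k := by
    rcases Nat.eq_zero_or_pos k with rfl | h
    · obtain ⟨C⟩ := hcol
      exact Or.inl ⟨fun v => (C v).elim0⟩
    · exact Or.inr h
  refine le_antisymm (ZDP_le (s := 0) hk ?_) zero_le
  refine ListDPColorable.dpColorable ?_ (hV.imp (fun h => ⟨fun p => p.elim h.elim Fin.elim0⟩) id)
  by_cases hkn' : Fintype.card V ≤ k + 2
  · refine listDPColorable_of_card_le hcol' (by simpa using hkn') ?_
    rintro ⟨e⟩
    exact hC ⟨(joinFinZeroIso G).symm.trans e⟩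
  · obtain rfl : k = 1 := by
      rcases hV with h | h
      · simp at hkn'
      · omega
    exact ListDPColorable.of_colorable_one hcol'

lemma colorable_two_of_iso (e : G ≃g SimpleGraph.cycleGraph 4) : G.Colorable 2 := by
  refine ⟨SimpleGraph.Coloring.mk (fun v => ⟨(e v).val % 2, Nat.mod_lt _ two_pos⟩) ?_⟩
  intro u v huv he
  have h1 := e.map_rel_iff.2 huv
  have h2 : (e u).val % 2 = (e v).val % 2 := congrArg Fin.val he
  revert h1 h2
  generalize e u = i
  generalize e v = j
  revert i j
  decide

lemma not_colorable_one_of_iso (e : G ≃g SimpleGraph.cycleGraph 4) : ¬ G.Colorable 1 := by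
  rintro ⟨C⟩
  have h : (SimpleGraph.cycleGraph 4).Adj 0 1 := by decide
  exact C.valid (e.symm.map_rel_iff.2 h) (Subsingleton.elim _ _)

/-- The four-cycle has a twofold cover without an independent transversal. -/
lemma not_dpColorable_two_of_iso [Fintype V] (e : G ≃g SimpleGraph.cycleGraph 4) :
    ¬ DPColorable G 2 := by
  intro h
  obtain ⟨c, hc⟩ := h.exists_permCover_choice
    -- Identity matchings on three edges force the ends of the path to differ; the swapped matching
    -- on the fourth edge forces them to agree.
    (fun u v => if (e u = 0 ∧ e v = 3) ∨ (e u = 3 ∧ e v = 0) then Equiv.swap 0 1 else 1)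
    (by
      intro u v
      by_cases h1 : (e u = 0 ∧ e v = 3) ∨ (e u = 3 ∧ e v = 0)
      · have h2 : (e v = 0 ∧ e u = 3) ∨ (e v = 3 ∧ e u = 0) := by tauto
        simp [h1, h2]
      · have h2 : ¬ ((e v = 0 ∧ e u = 3) ∨ (e v = 3 ∧ e u = 0)) := by tauto
        simp [h1, h2])
  have key : ∀ i j, (SimpleGraph.cycleGraph 4).Adj i j →
      (if (i = 0 ∧ j = 3) ∨ (i = 3 ∧ j = 0) then Equiv.swap 0 1 else 1 : Equiv.Perm (Fin 2))
        (c (e.symm i)) ≠ c (e.symm j) := by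
    intro i j hij
    have := hc (e.symm i) (e.symm j) (e.symm.map_rel_iff.2 hij)
    simpa using this
  have k1 := key 0 1 (by decide)
  have k2 := key 1 2 (by decide)
  have k3 := key 2 3 (by decide)
  have k4 := key 3 0 (by decide)
  revert k1 k2 k3 k4
  generalize c (e.symm 0) = c0
  generalize c (e.symm 1) = c1
  generalize c (e.symm 2) = c2
  generalize c (e.symm 3) = c3
  revert c0 c1 c2 c3
  decide

lemma ZDP_eq_one [Fintype V] {k : ℕ} (hk : G.chromaticNumber = k)
    (e : G ≃g SimpleGraph.cycleGraph 4) : ZDP G = 1 := by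
  have hcard : Fintype.card V = 4 := by simpa using Fintype.card_congr e.toEquiv
  have hcol : G.Colorable k := SimpleGraph.chromaticNumber_le_iff_colorable.1 hk.le
  have hge : ∀ m, G.Colorable m → 2 ≤ m := fun m hm => by
    by_contra! hlt
    exact not_colorable_one_of_iso e (hm.mono (by omega))
  refine le_antisymm (ZDP_le (s := 1) hk ?_) ?_
  · refine ListDPColorable.dpColorable (listDPColorable_of_card_le (colorable_join hcol) ?_ ?_)
      (Or.inr k.succ_pos)
    · have := hge k hcol
      rw [Fintype.card_sum, Fintype.card_fin]
      omega
    · rintro ⟨e'⟩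
      have := Fintype.card_congr e'.toEquiv
      rw [Fintype.card_sum, Fintype.card_fin, Fintype.card_fin] at this
      omega
  · refine le_iInf₂ fun s hs => ?_
    rcases Nat.eq_zero_or_pos s with rfl | hs0
    · exfalso
      have e' : join G (⊤ : SimpleGraph (Fin 0)) ≃g SimpleGraph.cycleGraph 4 :=
        (joinFinZeroIso G).trans e
      have h2 : dpChromaticNumber (join G (⊤ : SimpleGraph (Fin 0))) < (3 : ℕ) := by
        rw [show dpChromaticNumber (join G (⊤ : SimpleGraph (Fin 0))) = _ from hs]
        refine lt_of_le_of_lt (colorable_two_of_iso e').chromaticNumber_le ?_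
        exact_mod_cast Nat.lt_succ_self 2
      unfold dpChromaticNumber at h2
      simp only [iInf_lt_iff] at h2
      obtain ⟨m, hm, hm3⟩ := h2
      have hm3' : m < 3 := by exact_mod_cast hm3
      have hm2 : 2 ≤ m := by
        by_contra! hlt
        exact not_colorable_one_of_iso e' ((DPColorable.colorable hm).mono (by omega))
      obtain rfl : m = 2 := by omega
      exact not_dpColorable_two_of_iso e' hm
    · exact_mod_cast hs0

/-- The join with `2 |E(G)|` vertices has equal chromatic and DP-chromatic number. -/
theorem ZDP_le_two_mul_card_edgeFinset [Fintype V] [Fintype G.edgeSet] {k : ℕ}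
    (hk : G.chromaticNumber = k) (hpos : 0 < k) : ZDP G ≤ (2 * G.edgeFinset.card : ℕ) :=
  ZDP_le hk ((listDPColorable_join
    (SimpleGraph.chromaticNumber_le_iff_colorable.1 hk.le)).dpColorable (Or.inr (by omega)))

end Main

end DPColoring

theorem theorem1p8 {V : Type u} [Fintype V] (G : SimpleGraph V) [Fintype G.edgeSet]
    (n m k : ℕ) (hn : Fintype.card V = n) (hm : G.edgeFinset.card = m)
    (hk : G.chromaticNumber = k) :
    (2 ≤ k ∧ k + 3 ≤ n →
      DPColoring.ZDP G ≤ (⌈(4 * (k + 1) * m / (2 * k + 1) : ℚ)⌉₊ : ℕ∞) ∧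
      ⌈(4 * (k + 1) * m / (2 * k + 1) : ℚ)⌉₊ ≤ ⌈(2.4 * m : ℚ)⌉₊) ∧
    (Nonempty (G ≃g SimpleGraph.cycleGraph 4) → DPColoring.ZDP G = 1) ∧
    (¬ (2 ≤ k ∧ k + 3 ≤ n) → ¬ Nonempty (G ≃g SimpleGraph.cycleGraph 4) →
      DPColoring.ZDP G = 0) := by
  refine ⟨fun ⟨hk2, _⟩ => ⟨?_, ?_⟩, fun ⟨e⟩ => DPColoring.ZDP_eq_one hk e,
    fun h hC => DPColoring.ZDP_eq_zero hk (by omega) hC⟩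
  · refine (DPColoring.ZDP_le_two_mul_card_edgeFinset hk (by omega)).trans ?_
    rw [hm]
    -- Holds since `2 (2k + 1) ≤ 4 (k + 1)`.
    have h1 : ((2 * m : ℕ) : ℚ) ≤ 4 * (k + 1) * m / (2 * k + 1) := by
      rw [le_div_iff₀ (by positivity)]
      push_cast
      have : (0 : ℚ) ≤ m := by positivity
      linarith
    exact_mod_cast Nat.cast_le (α := ℚ).1 (h1.trans (Nat.le_ceil _))
  -- The inequality `4 (k + 1) ≤ 2.4 (2k + 1)` is equivalent to `k ≥ 2`.
  · refine Nat.ceil_mono ?_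
    rw [div_le_iff₀ (by positivity)]
    have h2 : (2 : ℚ) ≤ k := by exact_mod_cast hk2
    have : (0 : ℚ) ≤ m * (k - 2) := mul_nonneg (by positivity) (by linarith)
    linarith
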